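/- Consider a slotted wireless link ($t=0,1,2,\dots$) from an energy harvesting transmitter $S$ to an energy harvesting receiver $D$, both with infinite batteries. Fix a rate $R>0$, noise power $z>0$, $\alpha>0$, circuit power $P_{C,S}\ge 0$ and receiving power $P_D>0$, and put $c=(2^R-1)(1+\alpha)z$. The harvested energies $(E_S^t)_t$ and $(E_D^t)_t$ are nonnegative stationary ergodic sequences with finite means $\lambda_S,\lambda_D>0$. The nonnegative initial batteries $B_S^0,B_D^0$ may be random, and $(B_S^0,(E_S^t)_t)$ and $(B_D^0,(E_D^t)_t)$ are independent. The channel coefficients $h_t$ are independent over slots, with $|h_t|^2$ exponential of mean $1$ (Rayleigh fading), and are independent of everything else. If $S$ transmits with power $P_{tx}^t\ge 0$, it consumes $P_S^t=(1+\alpha)P_{tx}^t+P_{C,S}\mathbf 1_{P_{tx}^t>0}$, which may not exceed $B_S^t$; then $B_S^{t+1}=B_S^t-P_S^t+E_S^t$. The receiver consumes $P_D$ in exactly the slots with $B_D^t\ge P_D$, so $B_D^{t+1}=B_D^t-P_D\mathbf 1_{B_D^t\ge P_D}+E_D^t$. There is no battery-state sharing and no retransmission: a stationary power control policy chooses $P_{tx}^t$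 by a time-independent measurable rule from $S$'s own battery level $B_S^t$ and, possibly, private randomization that is independent over time and of everything else. The packet of slot $t$ is in outage unless $P_{tx}^t>0$, $B_D^t\ge P_D$ and $\log_2(1+|h_t|^2P_{tx}^t/z)\ge R$; the outage probability of a policy is the long-run average $\lim_n\frac1n\sum_{t<n}\Pr\{\text{packet } t\text{ in outage}\}$ (for policies without a limit, the lower limit is used, which only strengthens the claim). The disjoint threshold policy with threshold $P_S>P_{C,S}$ uses $P_S^t=P_S$ if $B_S^t\ge P_S$ and $P_S^t=0$ otherwise. Finally, if $\lambda_D<P_D$, assume that the receiver approaches a steady state, in the sense that $\Pr\{B_D^t\ge P_D\}$ converges as $t\to\infty$ (as it does if its battery process is stationary). Then the disjoint threshold policy with threshold $$P_S^*=\max(\lambda_S,B_{th}),\qquad B_{th}=\tfrac12\Big[(2P_{C,S}+c)+\sqrt{c\,(4P_{C,S}+c)}\Big],$$ satisfies $P_S^*>P_{C,S}$ and minimizes the outage probability among all stationary power control policies. Every disjoint threshold policy has an outage probability in the limit sense, and $P_S^*$ is the only optimal threshold: any other threshold $P_S>P_{C,S}$ gives a strictly larger outage probability. -/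

import Mathlib

open MeasureTheory ProbabilityTheory Filter Topology

noncomputable section

/-- Physical constants of the link: rate `R`, noise power `z`, amplifier coefficient `α`, static
circuit power `PC` of the transmitter, and power consumption `PD` of an active receiver. -/
structure EHLink where
  R : ℝ
  z : ℝ
  α : ℝ
  PC : ℝ
  PD : ℝ
  R_pos : 0 < R
  z_pos : 0 < z
  α_pos : 0 < α
  PC_nonneg : 0 ≤ PC
  PD_pos : 0 < PD

namespace EHLink

variable (L : EHLink)

/-- Power drawn from the battery of `S` when it transmits with power `p`: the circuit power is
consumed only in slots in which `S` transmits. -/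
def consumption (p : ℝ) : ℝ :=
  (1 + L.α) * p + if 0 < p then L.PC else 0

/-- `c = (2 ^ R - 1) (1 + α) z`. -/
def c : ℝ := ((2 : ℝ) ^ L.R - 1) * (1 + L.α) * L.z

/-- `B_th = ((2 P_C + c) + √(c (4 P_C + c))) / 2`. -/
def Bth : ℝ := (1 / 2) * ((2 * L.PC + L.c) + √(L.c * (4 * L.PC + L.c)))

/-- The mutual information of the channel with coefficient `h` at transmission power `p`. -/
def mutualInfo (p : ℝ) (h : ℂ) : ℝ := Real.logb 2 (1 + ‖h‖ ^ 2 * p / L.z)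

/-- Stationary power control policies of `S` without battery-state sharing and without
retransmission. The transmission power `π b u` in a slot depends only on the energy `b` in the
battery of `S` and on a private uniform variable `u` (randomized policies are allowed; a
deterministic policy ignores `u`). The consumed energy has to be in the battery. -/
structure IsStationaryPolicy (π : ℝ → unitInterval → ℝ) : Prop where
  measurable : Measurable (Function.uncurry π)
  nonneg : ∀ b, 0 ≤ b → ∀ u, 0 ≤ π b u
  consumption_le : ∀ b, 0 ≤ b → ∀ u, L.consumption (π b u) ≤ b

/-- The disjoint threshold policy with threshold `P`: consume exactly `P` (transmission power
`(P - P_C) / (1 + α)`) if the battery of `S` holds at least `P`, and stay silent otherwise. -/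
def thresholdPolicy (P : ℝ) : ℝ → unitInterval → ℝ :=
  fun b _ => if P ≤ b then (P - L.PC) / (1 + L.α) else 0

end EHLink

/-- The random inputs: harvested energies `ES t`, `ED t` in slot `t`, initial battery energies
`BS0`, `BD0`, the channel coefficients `h t`, and the randomization variables `U t` available to
randomized policies. -/
structure EHInputs (Ω : Type*) where
  ES : ℕ → Ω → ℝ
  ED : ℕ → Ω → ℝ
  BS0 : Ω → ℝ
  BD0 : Ω → ℝ
  U : ℕ → Ω → unitInterval
  h : ℕ → Ω → ℂ

/-- A real process indexed by `ℕ` is stationary and ergodic: the left shift preserves its law on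
the space of sequences and is ergodic for it. -/
def StationaryErgodic {Ω : Type*} [MeasurableSpace Ω] (E : ℕ → Ω → ℝ) (μ : Measure Ω) : Prop :=
  Ergodic (fun (x : ℕ → ℝ) (t : ℕ) => x (t + 1)) (μ.map (fun ω t => E t ω))

namespace EHInputs

variable {Ω : Type*} (X : EHInputs Ω)

/-- All randomness on the side of `S` that concerns energy. -/
def sideS (ω : Ω) : ℝ × (ℕ → ℝ) := (X.BS0 ω, fun t => X.ES t ω)

/-- All randomness on the side of `D` that concerns energy. -/
def sideD (ω : Ω) : ℝ × (ℕ → ℝ) := (X.BD0 ω, fun t => X.ED t ω)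

/-- The probabilistic assumptions on the inputs. -/
structure IsModel [MeasurableSpace Ω] (μ : Measure Ω) : Prop where
  measurable_ES : ∀ t, Measurable (X.ES t)
  measurable_ED : ∀ t, Measurable (X.ED t)
  measurable_BS0 : Measurable X.BS0
  measurable_BD0 : Measurable X.BD0
  measurable_U : ∀ t, Measurable (X.U t)
  measurable_h : ∀ t, Measurable (X.h t)
  ES_nonneg : ∀ t ω, 0 ≤ X.ES t ω
  ED_nonneg : ∀ t ω, 0 ≤ X.ED t ω
  BS0_nonneg : ∀ ω, 0 ≤ X.BS0 ω
  BD0_nonneg : ∀ ω, 0 ≤ X.BD0 ω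
  integrable_ES : Integrable (X.ES 0) μ
  integrable_ED : Integrable (X.ED 0) μ
  stationaryErgodic_ES : StationaryErgodic X.ES μ
  stationaryErgodic_ED : StationaryErgodic X.ED μ
  /-- the `U t` are i.i.d. uniform on `[0, 1]` -/
  uniform_U : ∀ t, μ.map (X.U t) = volume
  iIndep_U : iIndepFun X.U μ
  /-- Rayleigh block fading: independent `h t` with `|h t| ^ 2` exponential of mean one -/
  rayleigh_h : ∀ t, μ.map (fun ω => ‖X.h t ω‖ ^ 2) = expMeasure 1
  iIndep_h : iIndepFun X.h μ
  /-- mutual independence of the `S` side, the `D` side, the randomization and the fading -/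
  indep_S_D : IndepFun X.sideS X.sideD μ
  indep_U : IndepFun (fun ω => (X.sideS ω, X.sideD ω)) (fun ω t => X.U t ω) μ
  indep_h : IndepFun (fun ω => ((X.sideS ω, X.sideD ω), fun t => X.U t ω))
    (fun ω t => X.h t ω) μ

variable (L : EHLink)

/-- Battery energy of `S` at the beginning of slot `t` under the policy `π` (infinite capacity). -/
def batteryS (π : ℝ → unitInterval → ℝ) : ℕ → Ω → ℝ
  | 0, ω => X.BS0 ω
  | t + 1, ω =>
      batteryS π t ω - L.consumption (π (batteryS π t ω) (X.U t ω)) + X.ES t ω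

/-- Battery energy of `D` at the beginning of slot `t` (infinite capacity): `D` is active, and
consumes `P_D`, exactly in the slots in which its battery holds at least `P_D`. -/
def batteryD : ℕ → Ω → ℝ
  | 0, ω => X.BD0 ω
  | t + 1, ω =>
      batteryD t ω - (if L.PD ≤ batteryD t ω then L.PD else 0) + X.ED t ω

/-- Transmission power of `S` in slot `t` under the policy `π`. -/
def txPower (π : ℝ → unitInterval → ℝ) (t : ℕ) (ω : Ω) : ℝ :=
  π (X.batteryS L π t ω) (X.U t ω)

/-- The packet sent in slot `t` is in outage: `S` does not transmit, or `D` lacks the energy to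
receive, or the mutual information is below the rate. -/
def outageEvent (π : ℝ → unitInterval → ℝ) (t : ℕ) : Set Ω :=
  {ω | ¬ (0 < X.txPower L π t ω ∧ L.PD ≤ X.batteryD L t ω ∧
    L.R ≤ L.mutualInfo (X.txPower L π t ω) (X.h t ω))}

/-- Average of the packet outage probability over the first `n` slots. -/
def avgOutage [MeasurableSpace Ω] (μ : Measure Ω) (π : ℝ → unitInterval → ℝ) (n : ℕ) : ℝ :=
  (∑ t ∈ Finset.range n, μ.real (X.outageEvent L π t)) / n

end EHInputs

end

/-! By independence and the exponential law of the fading, a packet succeeds with probability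
`E[decodeProb]` times the probability that `D` is active (`measureReal_outageEvent`). The second
factor does not depend on the policy and averages to `min λ_D P_D / P_D` (`tendsto_avg_active`). Its
mean absolute deviation from this value also averages to zero, so the product separates in the long
run (`tendsto_avg_mul_sub`), and it remains to maximize the average decoding probability of `S`.

As a function of consumed power `P > P_C` this probability is `gain P = exp (-c / (P - P_C))`, and
silence contributes the point `(0, 0)`. The tangent to `gain` at `B_th` passes through the origin,
and at every `P ≥ B_th` the tangent lies above both the graph and the origin
(`decodeProb_le_tangent`). By energy conservation `S` spends at most `λ_S` per slot on average, so
the tangent at `max λ_S B_th`, evaluated at `λ_S`, bounds every policy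
(`eventually_avg_decodeProb_le`).

A threshold `P` yields `gain P * (min λ_S P / P)`. At `P = max λ_S B_th` this equals the bound
(`gain_mul_eq`). At any other threshold the tangent inequality is strict (`gain_mul_lt`). -/

/-! ### Mean ergodic theorem in `L¹`. -/

/-- `L¹` form of the mean ergodic theorem for square integrable observables. -/
theorem Ergodic.tendsto_integral_abs_birkhoffAverage_sub {α : Type*} [MeasurableSpace α]
    {ν : Measure α} [IsProbabilityMeasure ν] {T : α → α} (hT : Ergodic T ν) {f : α → ℝ}
    (hf : MemLp f 2 ν) :
    Tendsto (fun n => ∫ x, |birkhoffAverage ℝ T f n x - ∫ y, f y ∂ν| ∂ν) atTop (𝓝 0) := by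
  have hmp := hT.toMeasurePreserving
  let κ : Lp ℝ 2 ν →L[ℝ] Lp ℝ 2 ν :=
    (Lp.compMeasurePreservingₗᵢ ℝ T hmp).toContinuousLinearMap
  have hκ : ‖κ‖ ≤ 1 := LinearIsometry.norm_toContinuousLinearMap_le _
  have hκiter : ∀ n (F : Lp ℝ 2 ν), (κ^[n] F : α → ℝ) =ᵐ[ν] F ∘ T^[n] := by
    intro n F
    have h1 : κ^[n] F = Lp.compMeasurePreserving T^[n] (hmp.iterate n) F := by
      have := Lp.compMeasurePreserving_iterate (E := ℝ) (p := 2) hmp n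
      exact congrFun this F
    rw [h1]
    exact Lp.coeFn_compMeasurePreserving F (hmp.iterate n)
  set F : Lp ℝ 2 ν := hf.toLp f
  have hlim := κ.tendsto_birkhoffAverage_orthogonalProjection hκ F
  set G := (κ.eqLocus (1 : Lp ℝ 2 ν →L[ℝ] Lp ℝ 2 ν)).orthogonalProjectionOnto F
  have hGfix : κ (G : Lp ℝ 2 ν) = G := by
    have := G.2
    simpa using this
  -- The von Neumann limit is a fixed vector of the composition operator, hence an invariant
  -- function, which ergodicity makes constant.
  obtain ⟨k, hk⟩ : ∃ k : ℝ, ((G : Lp ℝ 2 ν) : α → ℝ) =ᵐ[ν] Function.const α k := by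
    refine hT.ae_eq_const_of_ae_eq_comp_ae (Lp.aestronglyMeasurable _) ?_
    have := hκiter 1 (G : Lp ℝ 2 ν)
    simp only [Function.iterate_one] at this
    rw [hGfix] at this
    exact this.symm
  have havg : ∀ n, ((birkhoffAverage ℝ κ _root_.id n F : Lp ℝ 2 ν) : α → ℝ)
      =ᵐ[ν] birkhoffAverage ℝ T f n := by
    intro n
    have h1 : ∀ i, (κ^[i] F : α → ℝ) =ᵐ[ν] f ∘ T^[i] := fun i =>
      (hκiter i F).trans ((hmp.iterate i).quasiMeasurePreserving.ae_eq hf.coeFn_toLp)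
    have h2 : ∀ m, ((birkhoffSum κ _root_.id m F : Lp ℝ 2 ν) : α → ℝ)
        =ᵐ[ν] birkhoffSum T f m := by
      intro m
      induction m with
      | zero => simpa using Lp.coeFn_zero ℝ 2 ν
      | succ m ih =>
        rw [birkhoffSum_succ]
        filter_upwards [Lp.coeFn_add (birkhoffSum κ _root_.id m F) (_root_.id (κ^[m] F)), ih, h1 m]
          with x e1 e2 e3
        rw [e1, birkhoffSum_succ, Pi.add_apply, e2]
        simp only [_root_.id, e3, Function.comp]
    unfold birkhoffAverage
    filter_upwards [Lp.coeFn_smul ((n : ℝ)⁻¹) (birkhoffSum κ _root_.id n F), h2 n] with x e1 e2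
    rw [e1, Pi.smul_apply, e2]
  have hf1 : Integrable f ν := hf.integrable one_le_two
  have hint : ∀ i, Integrable (fun x => f (T^[i] x)) ν := fun i =>
    (hmp.iterate i).integrable_comp_of_integrable hf1
  have hintavg : ∀ n, Integrable (birkhoffAverage ℝ T f n) ν := by
    intro n
    have : birkhoffAverage ℝ T f n
        = fun x => (n : ℝ)⁻¹ * ∑ i ∈ Finset.range n, f (T^[i] x) := by
      ext x; simp [birkhoffAverage, birkhoffSum]
    rw [this]
    exact (integrable_finsetSum _ fun i _ => hint i).const_mul _
  have hnorm : Tendsto (fun n => ∫ x, |birkhoffAverage ℝ T f n x - k| ∂ν) atTop (𝓝 0) := by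
    have h0 : Tendsto (fun n => ‖(birkhoffAverage ℝ κ _root_.id n F : Lp ℝ 2 ν) - G‖) atTop
        (𝓝 0) := tendsto_iff_norm_sub_tendsto_zero.1 hlim
    refine squeeze_zero (fun n => integral_nonneg fun x => abs_nonneg _) (fun n => ?_) h0
    set H : Lp ℝ 2 ν := (birkhoffAverage ℝ κ _root_.id n F : Lp ℝ 2 ν) - G
    have hH : (H : α → ℝ) =ᵐ[ν] fun x => birkhoffAverage ℝ T f n x - k := by
      filter_upwards [Lp.coeFn_sub (birkhoffAverage ℝ κ _root_.id n F : Lp ℝ 2 ν) (G : Lp ℝ 2 ν),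
        havg n, hk] with x e1 e2 e3
      rw [e1, Pi.sub_apply, e2, e3, Function.const]
    have hH1 : Integrable (H : α → ℝ) ν := (Lp.memLp H).integrable one_le_two
    calc ∫ x, |birkhoffAverage ℝ T f n x - k| ∂ν = ∫ x, ‖H x‖ ∂ν :=
          integral_congr_ae (hH.mono fun x hx => by simp only [hx, Real.norm_eq_abs])
      _ = (eLpNorm H 1 ν).toReal := by
          rw [eLpNorm_one_eq_lintegral_enorm, integral_norm_eq_lintegral_enorm hH1.1]
      _ ≤ (eLpNorm H 2 ν).toReal :=
          ENNReal.toReal_mono (Lp.memLp H).eLpNorm_ne_top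
            (eLpNorm_le_eLpNorm_of_exponent_le one_le_two hH1.1)
      _ = ‖H‖ := (Lp.norm_def H).symm
  have hmean : ∀ n : ℕ, 0 < n → ∫ x, birkhoffAverage ℝ T f n x ∂ν = ∫ y, f y ∂ν := by
    intro n hn
    have : birkhoffAverage ℝ T f n
        = fun x => (n : ℝ)⁻¹ * ∑ i ∈ Finset.range n, f (T^[i] x) := by
      ext x; simp [birkhoffAverage, birkhoffSum]
    rw [this, integral_const_mul, integral_finsetSum _ fun i _ => hint i]
    have h3 : ∀ i, ∫ x, f (T^[i] x) ∂ν = ∫ y, f y ∂ν := fun i => by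
      have := (hmp.iterate i).map_eq
      conv_rhs => rw [← this]
      rw [integral_map (hmp.iterate i).aemeasurable (by rw [this]; exact hf1.1)]
    simp only [h3, Finset.sum_const, Finset.card_range, nsmul_eq_mul]
    field_simp
  -- Every average with `n > 0` has the integral of `f`, so `L¹` convergence forces the constant to
  -- be that integral.
  have hkf : k = ∫ y, f y ∂ν := by
    have hle : ∀ᶠ n : ℕ in atTop, |(∫ y, f y ∂ν) - k|
        ≤ ∫ x, |birkhoffAverage ℝ T f n x - k| ∂ν := by
      filter_upwards [eventually_gt_atTop 0] with n hn
      have : (∫ y, f y ∂ν) - k = ∫ x, (birkhoffAverage ℝ T f n x - k) ∂ν := by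
        rw [integral_sub (hintavg n) (integrable_const k), hmean n hn]; simp
      rw [this]
      exact abs_integral_le_integral_abs
    have := ge_of_tendsto hnorm hle
    linarith [abs_eq_zero.1 (le_antisymm this (abs_nonneg _))]
  rwa [hkf] at hnorm

/-! ### Pathwise energy bookkeeping. -/

/-- Energy conservation for a battery that loses `q t` and gains `e t` in slot `t`. -/
theorem battery_eq_sum {b q e : ℕ → ℝ} (hb : ∀ t, b (t + 1) = b t - q t + e t) (n : ℕ) :
    b n = b 0 - ∑ t ∈ Finset.range n, q t + ∑ t ∈ Finset.range n, e t := by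
  induction n with
  | zero => simp
  | succ n ih => rw [hb, ih, Finset.sum_range_succ, Finset.sum_range_succ]; ring

/-- A battery drained by `P` whenever it holds `P` serves a number of slots that is bounded below
by a linear lower bound on the accumulated energy. -/
theorem le_drained_of_le_harvested {b e : ℕ → ℝ} {P κ C : ℝ} (hP : 0 < P) (hC : 0 ≤ C)
    (hb0 : 0 ≤ b 0) (hb : ∀ t, b (t + 1) = b t - (if P ≤ b t then P else 0) + e t) {n : ℕ}
    (he : ∀ τ ≤ n, κ * τ - C ≤ ∑ t ∈ Finset.range τ, e t) :
    min κ P * n - C - 2 * P ≤ ∑ t ∈ Finset.range n, (if P ≤ b t then P else 0) := by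
  induction n with
  | zero => simp; linarith
  | succ n ih =>
    specialize ih fun τ hτ => he τ (by omega)
    have hcons := battery_eq_sum hb n
    have hs := he n (by omega)
    have h1 := min_le_left κ P
    have h2 := min_le_right κ P
    have h3 : min κ P * n ≤ κ * n := mul_le_mul_of_nonneg_right h1 (Nat.cast_nonneg n)
    rw [Finset.sum_range_succ]
    push_cast
    split_ifs with h
    -- An active slot adds `P ≥ min κ P` to the induction hypothesis. In an idle slot the battery is
    -- below `P`, so conservation alone gives the bound: one `P` is the leftover charge, the other
    -- pays for the step from `n` to `n + 1`.
    · linarith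
    · push Not at h
      linarith

/-- Truncation only lowers the harvest, each complete block of length `m` falls short of `m * κ` by
at most its deviation, and the incomplete block costs at most `κ * m`. Summing deviations up to `n /
m` makes the error uniform in `τ ≤ n`, as `le_drained_of_le_harvested` requires. -/
theorem le_sum_range_of_block_deviation {e : ℕ → ℝ} (he : ∀ t, 0 ≤ e t) {κ : ℝ} (hκ : 0 ≤ κ)
    (K : ℝ) {m : ℕ} (hm : 0 < m) {n τ : ℕ} (hτ : τ ≤ n) :
    κ * τ - (κ * m + ∑ j ∈ Finset.range (n / m),
      |∑ i ∈ Finset.range m, min (e (i + j * m)) K - m * κ|) ≤ ∑ t ∈ Finset.range τ, e t := by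
  set dev : ℕ → ℝ := fun j => |∑ i ∈ Finset.range m, min (e (i + j * m)) K - m * κ|
  have h1 : ∀ q : ℕ, κ * (q * m : ℕ) - ∑ j ∈ Finset.range q, dev j
      ≤ ∑ t ∈ Finset.range (q * m), e t := by
    intro q
    induction q with
    | zero => simp
    | succ q ih =>
      have h2 : ∑ t ∈ Finset.range ((q + 1) * m), e t
          = ∑ t ∈ Finset.range (q * m), e t + ∑ i ∈ Finset.range m, e (i + q * m) := by
        rw [add_mul, one_mul, Finset.sum_range_add]
        simp only [add_comm]
      have h3 : ∑ i ∈ Finset.range m, min (e (i + q * m)) K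
          ≤ ∑ i ∈ Finset.range m, e (i + q * m) :=
        Finset.sum_le_sum fun i _ => min_le_left _ _
      have h4 := neg_abs_le (∑ i ∈ Finset.range m, min (e (i + q * m)) K - m * κ)
      rw [h2, Finset.sum_range_succ]
      push_cast at ih ⊢
      simp only [dev] at ih ⊢
      linarith
  have h5 := h1 (τ / m)
  have h6 : ∑ t ∈ Finset.range (τ / m * m), e t ≤ ∑ t ∈ Finset.range τ, e t :=
    Finset.sum_le_sum_of_subset_of_nonneg
      (Finset.range_subset_range.2 (Nat.div_mul_le_self τ m)) fun i _ _ => he i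
  have h7 : ∑ j ∈ Finset.range (τ / m), dev j ≤ ∑ j ∈ Finset.range (n / m), dev j :=
    Finset.sum_le_sum_of_subset_of_nonneg
      (Finset.range_subset_range.2 (Nat.div_le_div_right hτ)) fun i _ _ => abs_nonneg _
  have h8 : (τ : ℝ) ≤ (τ / m * m : ℕ) + m := by
    exact_mod_cast (Nat.lt_div_mul_add hm).le
  have h9 := mul_le_mul_of_nonneg_left h8 hκ
  linarith

/-! ### Long-run averages under stationary ergodic harvests. -/

section battery

variable {Ω : Type*} [MeasurableSpace Ω] {μ : Measure Ω}

theorem iterate_shift (n : ℕ) (x : ℕ → ℝ) :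
    (fun (x : ℕ → ℝ) (t : ℕ) => x (t + 1))^[n] x = fun t => x (t + n) := by
  induction n generalizing x with
  | zero => rfl
  | succ n ih =>
    rw [Function.iterate_succ_apply, ih]
    ext t
    simp only [add_assoc]

namespace StationaryErgodic

variable {E : ℕ → Ω → ℝ}

theorem integral_comp_shift (hE : StationaryErgodic E μ) (hm : ∀ t, Measurable (E t))
    {F : (ℕ → ℝ) → ℝ} (hF : Measurable F) (n : ℕ) :
    ∫ ω, F (fun t => E (t + n) ω) ∂μ = ∫ ω, F (fun t => E t ω) ∂μ := by
  have hX : Measurable fun ω t => E t ω := measurable_pi_lambda _ hm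
  have hmp := hE.toMeasurePreserving.iterate n
  have h1 : ∫ x, F ((fun (x : ℕ → ℝ) (t : ℕ) => x (t + 1))^[n] x) ∂(μ.map fun ω t => E t ω)
      = ∫ x, F x ∂(μ.map fun ω t => E t ω) := by
    conv_rhs => rw [← hmp.map_eq]
    rw [integral_map hmp.measurable.aemeasurable hF.aestronglyMeasurable]
  have hF' : Measurable fun x => F ((fun (x : ℕ → ℝ) (t : ℕ) => x (t + 1))^[n] x) :=
    hF.comp hmp.measurable
  rw [integral_map hX.aemeasurable hF'.aestronglyMeasurable,
    integral_map hX.aemeasurable hF.aestronglyMeasurable] at h1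
  simpa only [iterate_shift] using h1

theorem integral_eq (hE : StationaryErgodic E μ) (hm : ∀ t, Measurable (E t)) (t : ℕ) :
    ∫ ω, E t ω ∂μ = ∫ ω, E 0 ω ∂μ := by
  simpa using hE.integral_comp_shift hm (measurable_pi_apply 0) t

theorem integrable (hE : StationaryErgodic E μ) (hm : ∀ t, Measurable (E t))
    (hi : Integrable (E 0) μ) (t : ℕ) : Integrable (E t) μ := by
  have hX : Measurable fun ω t => E t ω := measurable_pi_lambda _ hm
  have hmp := hE.toMeasurePreserving.iterate t
  have h0 : Integrable (fun x : ℕ → ℝ => x 0) (μ.map fun ω t => E t ω) :=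
    (integrable_map_measure (measurable_pi_apply 0).aestronglyMeasurable hX.aemeasurable).2 hi
  have h1 := hmp.integrable_comp_of_integrable h0
  have h2 := (integrable_map_measure h1.1 hX.aemeasurable).1 h1
  refine h2.congr (ae_of_all _ fun ω => ?_)
  simp [iterate_shift]

variable [IsProbabilityMeasure μ]

/-- Long blocks of the truncated process have averages close to their mean. -/
theorem exists_block (hE : StationaryErgodic E μ) (hm : ∀ t, Measurable (E t))
    (h0 : ∀ t ω, 0 ≤ E t ω) {K : ℝ} (hK : 0 ≤ K) {ε : ℝ} (hε : 0 < ε) :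
    ∃ m : ℕ, 0 < m ∧ ∀ j, ∫ ω, |∑ i ∈ Finset.range m, min (E (i + j * m) ω) K
      - m * ∫ ω, min (E 0 ω) K ∂μ| ∂μ ≤ ε * m := by
  have hX : Measurable fun ω t => E t ω := measurable_pi_lambda _ hm
  have hf : Measurable fun x : ℕ → ℝ => min (x 0) K :=
    (measurable_pi_apply 0).min measurable_const
  have : IsProbabilityMeasure (μ.map fun ω t => E t ω) :=
    Measure.isProbabilityMeasure_map hX.aemeasurable
  have hmem : MemLp (fun x : ℕ → ℝ => min (x 0) K) 2 (μ.map fun ω t => E t ω) := by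
    refine MemLp.of_bound hf.aestronglyMeasurable K ?_
    rw [ae_map_iff hX.aemeasurable (measurableSet_le (by fun_prop) (by fun_prop))]
    refine ae_of_all _ fun ω => ?_
    rw [Real.norm_eq_abs, abs_of_nonneg (le_min (h0 0 ω) hK)]
    exact min_le_right _ _
  have hlim := Ergodic.tendsto_integral_abs_birkhoffAverage_sub hE hmem
  obtain ⟨m, hmε, hm0⟩ :=
    ((hlim.eventually (gt_mem_nhds hε)).and (eventually_gt_atTop 0)).exists
  refine ⟨m, hm0, fun j => ?_⟩
  set κ := ∫ ω, min (E 0 ω) K ∂μ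
  have hκ : ∫ x, min (x 0) K ∂(μ.map fun ω t => E t ω) = κ :=
    integral_map hX.aemeasurable hf.aestronglyMeasurable
  have hF : Measurable fun x : ℕ → ℝ => |∑ i ∈ Finset.range m, min (x i) K - m * κ| := by
    fun_prop
  have hsh := hE.integral_comp_shift hm hF (j * m)
  have hm0' : (0 : ℝ) < m := by exact_mod_cast hm0
  have hav : ∀ x, |birkhoffAverage ℝ (fun (x : ℕ → ℝ) (t : ℕ) => x (t + 1))
      (fun x : ℕ → ℝ => min (x 0) K) m x - κ|
      = (m : ℝ)⁻¹ * |∑ i ∈ Finset.range m, min (x i) K - m * κ| := by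
    intro x
    have : birkhoffAverage ℝ (fun (x : ℕ → ℝ) (t : ℕ) => x (t + 1))
      (fun x : ℕ → ℝ => min (x 0) K) m x - κ
      = (m : ℝ)⁻¹ * (∑ i ∈ Finset.range m, min (x i) K - m * κ) := by
      simp only [birkhoffAverage, birkhoffSum, iterate_shift, smul_eq_mul, zero_add]
      field_simp
    rw [this, abs_mul, abs_of_pos (inv_pos.2 hm0')]
  simp only [hκ, hav] at hmε
  rw [integral_const_mul, integral_map hX.aemeasurable hF.aestronglyMeasurable,
    inv_mul_lt_iff₀ hm0'] at hmε
  rw [hsh]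
  linarith

end StationaryErgodic

variable [IsProbabilityMeasure μ]

/-- Truncated harvests are bounded, hence square integrable as the mean ergodic step demands;
dominated convergence makes the loss of mean arbitrarily small. -/
theorem exists_truncation {f : Ω → ℝ} (hf : Integrable f μ) (h0 : ∀ ω, 0 ≤ f ω) {ε : ℝ}
    (hε : 0 < ε) : ∃ K : ℝ, 0 ≤ K ∧ ∫ ω, f ω ∂μ - ε < ∫ ω, min (f ω) K ∂μ := by
  have hlim : Tendsto (fun K : ℕ => ∫ ω, min (f ω) K ∂μ) atTop (𝓝 (∫ ω, f ω ∂μ)) := by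
    refine tendsto_integral_of_dominated_convergence f
      (fun K => (hf.inf (integrable_const (K : ℝ))).1) hf (fun K => ae_of_all _ fun ω => ?_)
      (ae_of_all _ fun ω => ?_)
    · rw [Real.norm_eq_abs, abs_of_nonneg (le_min (h0 ω) (Nat.cast_nonneg K))]
      exact min_le_left _ _
    · refine tendsto_const_nhds.congr' ?_
      filter_upwards [eventually_ge_atTop ⌈f ω⌉₊] with K hK
      exact (min_eq_left ((Nat.le_ceil _).trans (by exact_mod_cast hK))).symm
  obtain ⟨K, hK⟩ := (hlim.eventually (lt_mem_nhds (sub_lt_self _ hε))).exists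
  exact ⟨K, Nat.cast_nonneg K, hK⟩

/-- A reward that is at most affine in the energy spent has at most the corresponding affine
function of the harvesting rate as its long-run average, whatever the initial energy. -/
theorem eventually_avg_integral_le {E φ : ℕ → Ω → ℝ} {B₀ : Ω → ℝ} (hE : StationaryErgodic E μ)
    (hm : ∀ t, Measurable (E t)) (h0 : ∀ t ω, 0 ≤ E t ω) (hi : Integrable (E 0) μ)
    (hB : Measurable B₀) (hφm : ∀ t, Measurable (φ t))
    (hφ0 : ∀ t ω, 0 ≤ φ t ω) (hφ1 : ∀ t ω, φ t ω ≤ 1) {A s : ℝ} (hA : 0 ≤ A) (hs : 0 ≤ s)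
    (hφ : ∀ n ω, ∑ t ∈ Finset.range n, φ t ω
      ≤ n * A + s * (B₀ ω + ∑ t ∈ Finset.range n, E t ω))
    {ε : ℝ} (hε : 0 < ε) :
    ∀ᶠ n : ℕ in atTop,
      (∑ t ∈ Finset.range n, ∫ ω, φ t ω ∂μ) / n ≤ A + s * (∫ ω, E 0 ω ∂μ) + ε := by
  have htail : Tendsto (fun M : ℕ => μ.real {ω | (M : ℝ) < B₀ ω}) atTop (𝓝 0) := by
    have h1 : Tendsto (fun M : ℕ => μ {ω | (M : ℝ) < B₀ ω}) atTop
        (𝓝 (μ (⋂ M : ℕ, {ω | (M : ℝ) < B₀ ω}))) := by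
      refine tendsto_measure_iInter_atTop
        (fun M => (measurableSet_lt measurable_const hB).nullMeasurableSet) ?_
        ⟨0, measure_ne_top _ _⟩
      intro a b hab ω hω
      exact lt_of_le_of_lt (Nat.cast_le.2 hab : (a : ℝ) ≤ b) hω
    have h2 : (⋂ M : ℕ, {ω | (M : ℝ) < B₀ ω}) = ∅ := by
      ext ω
      simp only [Set.mem_iInter, Set.mem_ofPred_eq, Set.mem_empty_iff_false, iff_false, not_forall,
        not_lt]
      exact ⟨_, Nat.le_ceil _⟩
    rw [h2, measure_empty] at h1
    exact (ENNReal.tendsto_toReal ENNReal.zero_ne_top).comp h1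
  -- The initial energy need not be integrable. Off an event of probability below `ε / 2` it is at
  -- most `M`, which vanishes after division by `n`; on that event the reward is bounded by `n`.
  obtain ⟨M, hM⟩ := (htail.eventually (gt_mem_nhds (half_pos hε))).exists
  set S : Set Ω := {ω | (M : ℝ) < B₀ ω}
  have hS : MeasurableSet S := measurableSet_lt measurable_const hB
  have hφi : ∀ t, Integrable (φ t) μ := fun t =>
    Integrable.of_bound (hφm t).aestronglyMeasurable 1
      (ae_of_all _ fun ω => by rw [Real.norm_eq_abs, abs_of_nonneg (hφ0 t ω)]; exact hφ1 t ω)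
  have hEi := hE.integrable hm hi
  have key : ∀ n : ℕ, ∑ t ∈ Finset.range n, ∫ ω, φ t ω ∂μ
      ≤ n * μ.real S + n * A + s * M + s * (n * ∫ ω, E 0 ω ∂μ) := by
    intro n
    rw [← integral_finsetSum _ fun t _ => hφi t]
    have hint : Integrable (fun ω => S.indicator (fun _ => (n : ℝ)) ω
        + (n * A + s * M + s * ∑ t ∈ Finset.range n, E t ω)) μ :=
      ((integrable_const _).indicator hS).add
        ((integrable_const _).add ((integrable_finsetSum _ fun t _ => hEi t).const_mul s))
    calc ∫ ω, ∑ t ∈ Finset.range n, φ t ω ∂μ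
        ≤ ∫ ω, (S.indicator (fun _ => (n : ℝ)) ω
        + (n * A + s * M + s * ∑ t ∈ Finset.range n, E t ω)) ∂μ := by
          refine integral_mono (integrable_finsetSum _ fun t _ => hφi t) hint fun ω => ?_
          have hsum : 0 ≤ ∑ t ∈ Finset.range n, E t ω := Finset.sum_nonneg fun t _ => h0 t ω
          by_cases hω : ω ∈ S
          · simp only [Set.indicator_of_mem hω]
            have h1 : ∑ t ∈ Finset.range n, φ t ω ≤ n := by
              simpa using Finset.sum_le_card_nsmul (Finset.range n) (fun t => φ t ω) 1
                fun t _ => hφ1 t ω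
            have : 0 ≤ n * A + s * M + s * ∑ t ∈ Finset.range n, E t ω := by positivity
            linarith
          · simp only [Set.indicator_of_notMem hω]
            have h1 := hφ n ω
            have h2 : B₀ ω ≤ M := not_lt.1 hω
            have h3 := mul_le_mul_of_nonneg_left h2 hs
            linarith
      _ = n * μ.real S + n * A + s * M + s * (n * ∫ ω, E 0 ω ∂μ) := by
          have hsum : Integrable (fun ω => s * ∑ t ∈ Finset.range n, E t ω) μ :=
            (integrable_finsetSum _ fun t _ => hEi t).const_mul s
          have hadd : Integrable (fun ω => n * A + s * M + s * ∑ t ∈ Finset.range n, E t ω) μ :=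
            (integrable_const _).add hsum
          rw [integral_add ((integrable_const _).indicator hS) hadd,
            integral_add (integrable_const _) hsum, integral_const_mul,
            integral_finsetSum _ fun t _ => hEi t, integral_indicator_const _ hS]
          simp only [hE.integral_eq hm, Finset.sum_const, Finset.card_range, nsmul_eq_mul,
            integral_const, probReal_univ, smul_eq_mul]
          ring
  have hlim : Tendsto (fun n : ℕ => s * M / (n : ℝ)) atTop (𝓝 0) :=
    tendsto_const_div_atTop_nhds_zero_nat _
  filter_upwards [hlim.eventually (gt_mem_nhds (half_pos hε)), eventually_gt_atTop 0] with n h1 hn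
  have hn' : (0 : ℝ) < n := by exact_mod_cast hn
  rw [div_lt_iff₀ hn'] at h1
  rw [div_le_iff₀ hn']
  have := key n
  have h3 := mul_le_mul_of_nonneg_left hM.le hn'.le
  linarith

/-- A battery with stationary ergodic harvest of mean `λ`, drained by `P` in exactly the slots in
which it holds `P`, is active in a long-run fraction `min λ P / P` of the slots. -/
theorem tendsto_avg_active {E B : ℕ → Ω → ℝ} (hE : StationaryErgodic E μ)
    (hm : ∀ t, Measurable (E t)) (h0 : ∀ t ω, 0 ≤ E t ω) (hi : Integrable (E 0) μ)
    (hBm : ∀ t, Measurable (B t)) (hB0 : ∀ ω, 0 ≤ B 0 ω) {P : ℝ} (hP : 0 < P)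
    (hB : ∀ t ω, B (t + 1) ω = B t ω - (if P ≤ B t ω then P else 0) + E t ω) :
    Tendsto (fun n : ℕ => (∑ t ∈ Finset.range n, μ.real {ω | P ≤ B t ω}) / n) atTop
      (𝓝 (min (∫ ω, E 0 ω ∂μ) P / P)) := by
  set lam := ∫ ω, E 0 ω ∂μ with hlam
  have hlam0 : 0 ≤ lam := integral_nonneg (h0 0)
  have hms : ∀ t, MeasurableSet {ω | P ≤ B t ω} := fun t =>
    measurableSet_le measurable_const (hBm t)
  have hpt : ∀ ω n, B n ω = B 0 ω - ∑ t ∈ Finset.range n, (if P ≤ B t ω then P else 0)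
      + ∑ t ∈ Finset.range n, E t ω := fun ω n =>
    battery_eq_sum (b := fun t => B t ω) (e := fun t => E t ω) (fun t => hB t ω) n
  have hBnn : ∀ n ω, 0 ≤ B n ω := by
    intro n ω
    induction n with
    | zero => exact hB0 ω
    | succ n ih =>
      rw [hB]
      have := h0 n ω
      split_ifs <;> linarith
  set φ : ℕ → Ω → ℝ := fun t => {ω | P ≤ B t ω}.indicator 1 with hφdef
  have hφi : ∀ t, Integrable (φ t) μ := fun t => (integrable_const (1 : ℝ)).indicator (hms t)
  have hφint : ∀ t, ∫ ω, φ t ω ∂μ = μ.real {ω | P ≤ B t ω} := fun t =>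
    integral_indicator_one (hms t)
  have hφP : ∀ t ω, (if P ≤ B t ω then P else 0) = P * φ t ω := by
    intro t ω
    simp only [hφdef, Set.indicator_apply, Set.mem_ofPred_eq, Pi.one_apply]
    split_ifs <;> simp
  have upper : ∀ ε : ℝ, 0 < ε → ∀ᶠ n : ℕ in atTop,
      (∑ t ∈ Finset.range n, μ.real {ω | P ≤ B t ω}) / n ≤ min lam P / P + ε := by
    intro ε hε
    -- Each active slot costs `P`, so the number of active slots is at most the total energy times
    -- `P⁻¹`.
    have h1 := eventually_avg_integral_le (φ := φ) (B₀ := B 0) (A := 0) (s := P⁻¹) hE hm h0 hi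
      (hBm 0) (fun t => measurable_const.indicator (hms t))
      (fun t ω => Set.indicator_nonneg (fun _ _ => zero_le_one) _)
      (fun t ω => Set.indicator_le_self' (fun _ _ => zero_le_one) ω) le_rfl (inv_pos.2 hP).le
      (fun n ω => by
        have := hpt ω n
        have h2 := hBnn n ω
        simp only [hφP, ← Finset.mul_sum] at this
        rw [mul_zero, zero_add, le_inv_mul_iff₀ hP]
        linarith) hε
    filter_upwards [h1, eventually_gt_atTop 0] with n h2 hn
    simp only [hφint] at h2
    have hn' : (0 : ℝ) < n := by exact_mod_cast hn
    rcases min_choice lam P with h | h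
    · rw [h, div_eq_inv_mul lam P]
      linarith
    · rw [h, div_self hP.ne']
      have : (∑ t ∈ Finset.range n, μ.real {ω | P ≤ B t ω}) / n ≤ 1 := by
        rw [div_le_one hn']
        simpa using Finset.sum_le_card_nsmul (Finset.range n)
          (fun t => μ.real {ω | P ≤ B t ω}) 1 fun t _ => measureReal_le_one
      linarith
  have lower : ∀ ε : ℝ, 0 < ε → ∀ᶠ n : ℕ in atTop,
      min lam P / P - ε ≤ (∑ t ∈ Finset.range n, μ.real {ω | P ≤ B t ω}) / n := by
    intro ε hε
    -- One third each for the truncation, the block deviations and the boundary term `κ * m + 2 *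
    -- P`; the factor `P` cancels in the final division.
    have hε' : 0 < ε * P / 3 := by positivity
    obtain ⟨K, hK, hKlam⟩ := exists_truncation hi (h0 0) hε'
    obtain ⟨m, hm0, hdev⟩ := hE.exists_block hm h0 hK hε'
    set κ := ∫ ω, min (E 0 ω) K ∂μ with hκ
    have hκ0 : 0 ≤ κ := integral_nonneg fun ω => le_min (h0 0 ω) hK
    have hm0' : (0 : ℝ) < m := by exact_mod_cast hm0
    have hdevi : ∀ j, Integrable
        (fun ω => |∑ i ∈ Finset.range m, min (E (i + j * m) ω) K - m * κ|) μ := fun j =>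
      ((integrable_finsetSum _ fun i _ =>
        (hE.integrable hm hi (i + j * m)).inf (integrable_const K)).sub
          (integrable_const _)).abs
    have key : ∀ n : ℕ, min κ P * n - κ * m - 2 * P - n * (ε * P / 3)
        ≤ P * ∑ t ∈ Finset.range n, μ.real {ω | P ≤ B t ω} := by
      intro n
      have hp : ∀ ω, min κ P * n - κ * m - 2 * P
          - ∑ j ∈ Finset.range (n / m),
            |∑ i ∈ Finset.range m, min (E (i + j * m) ω) K - m * κ|
          ≤ P * ∑ t ∈ Finset.range n, φ t ω := by
        intro ω
        have h1 := le_drained_of_le_harvested (b := fun t => B t ω) (e := fun t => E t ω)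
          (κ := κ) (n := n) hP
          (C := κ * m + ∑ j ∈ Finset.range (n / m),
            |∑ i ∈ Finset.range m, min (E (i + j * m) ω) K - m * κ|)
          (add_nonneg (by positivity) (Finset.sum_nonneg fun _ _ => abs_nonneg _))
          (hB0 ω) (fun t => hB t ω)
          (fun τ hτ => le_sum_range_of_block_deviation (fun t => h0 t ω) hκ0 K hm0 hτ)
        simp only [hφP, ← Finset.mul_sum] at h1
        linarith
      have h2 := integral_mono
        ((integrable_const (μ := μ) (min κ P * n - κ * m - 2 * P)).sub
          (integrable_finsetSum (Finset.range (n / m)) fun j _ => hdevi j))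
        ((integrable_finsetSum (Finset.range n) fun t _ => hφi t).const_mul P) hp
      rw [integral_const_mul, integral_finsetSum _ fun t _ => hφi t] at h2
      simp only [Pi.sub_apply] at h2
      rw [integral_sub (integrable_const _) (integrable_finsetSum _ fun j _ => hdevi j),
        integral_finsetSum _ fun j _ => hdevi j] at h2
      simp only [hφint, integral_const, probReal_univ, one_smul] at h2
      have h3 : ∑ j ∈ Finset.range (n / m),
          ∫ ω, |∑ i ∈ Finset.range m, min (E (i + j * m) ω) K - m * κ| ∂μ
          ≤ (n / m : ℕ) * (ε * P / 3 * m) := by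
        simpa using Finset.sum_le_card_nsmul (Finset.range (n / m)) _ _ fun j _ => hdev j
      have h4 : ((n / m : ℕ) : ℝ) * m ≤ n := by exact_mod_cast Nat.div_mul_le_self n m
      have h5 := mul_le_mul_of_nonneg_left h4 hε'.le
      linarith
    have hlim : Tendsto (fun n : ℕ => (κ * m + 2 * P) / (n : ℝ)) atTop (𝓝 0) :=
      tendsto_const_div_atTop_nhds_zero_nat _
    filter_upwards [hlim.eventually (gt_mem_nhds hε'), eventually_gt_atTop 0] with n h1 hn
    have hn' : (0 : ℝ) < n := by exact_mod_cast hn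
    rw [div_lt_iff₀ hn'] at h1
    have h2 : min lam P - ε * P / 3 ≤ min κ P := by
      refine le_min ?_ ?_
      · linarith [min_le_left lam P]
      · linarith [min_le_right lam P]
    have h3 := mul_le_mul_of_nonneg_right h2 hn'.le
    have h4 := key n
    rw [le_div_iff₀ hn', sub_mul, div_mul_eq_mul_div, sub_le_iff_le_add, div_le_iff₀ hP]
    linarith
  refine tendsto_order.2 ⟨fun a ha => ?_, fun a ha => ?_⟩
  · filter_upwards [lower ((min lam P / P - a) / 2) (by linarith)] with n hn
    linarith
  · filter_upwards [upper ((a - min lam P / P) / 2) (by linarith)] with n hn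
    linarith

end battery

/-! ### Tangents to the decoding probability. -/

/-- Tangent line inequality for `x ↦ exp (-c / x)` at a point `y ≥ c`. -/
theorem exp_neg_div_lt_tangent {c x y : ℝ} (hc : 0 < c) (hx : 0 < x) (hy : c ≤ y) (hxy : x ≠ y) :
    Real.exp (-c / x) < Real.exp (-c / y) + Real.exp (-c / y) * c / y ^ 2 * (x - y) := by
  have hy0 : 0 < y := hc.trans_le hy
  set v := c / x - c / y with hv
  have hv0 : v ≠ 0 := by
    intro h
    rw [hv, sub_eq_zero, div_eq_div_iff hx.ne' hy0.ne'] at h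
    exact hxy (mul_left_cancel₀ hc.ne' h).symm
  have h1 : v + 1 < Real.exp v := Real.add_one_lt_exp hv0
  have hcx : 0 < c / x := div_pos hc hx
  have hcy : c / y ≤ 1 := (div_le_one hy0).2 hy
  have hpos : 0 < v + 1 := by linarith
  have h2 : Real.exp (-c / x) = Real.exp (-c / y) * (Real.exp v)⁻¹ := by
    rw [← Real.exp_neg, ← Real.exp_add]; congr 1; rw [hv]; ring
  have h3 : (Real.exp v)⁻¹ < (v + 1)⁻¹ := inv_strictAnti₀ hpos h1
  -- Replacing `exp (-v)` by `1 / (v + 1)` leaves a rational inequality whose defect is a square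
  -- times `y - c`. Hence only the point of contact must satisfy `c ≤ y`; `x` may lie where the
  -- function is not concave.
  have h4 : (v + 1)⁻¹ ≤ 1 + c / y ^ 2 * (x - y) := by
    rw [inv_le_iff_one_le_mul₀ hpos]
    have : (1 + c / y ^ 2 * (x - y)) * (v + 1)
        = 1 + c * (y - c) * (x - y) ^ 2 / (x * y ^ 3) := by
      rw [hv]; field_simp; ring
    rw [this]
    have : 0 ≤ c * (y - c) * (x - y) ^ 2 / (x * y ^ 3) := by
      have := sub_nonneg.2 hy
      positivity
    linarith
  have he := Real.exp_pos (-c / y)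
  calc Real.exp (-c / x) < Real.exp (-c / y) * (1 + c / y ^ 2 * (x - y)) := by
        rw [h2]; exact mul_lt_mul_of_pos_left (h3.trans_le h4) he
    _ = _ := by ring

namespace EHLink

variable (L : EHLink)

theorem c_pos : 0 < L.c := by
  have h1 : (1 : ℝ) < 2 ^ L.R := Real.one_lt_rpow one_lt_two L.R_pos
  have := L.α_pos
  have := L.z_pos
  have : 0 < (2 : ℝ) ^ L.R - 1 := by linarith
  unfold c
  positivity

/-- The condition `(P - P_C) ^ 2 = c * P` says that the tangent to `gain` at `P` passes through the
origin; `Bth` is its larger root. -/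
theorem Bth_sub_PC_sq : (L.Bth - L.PC) ^ 2 = L.c * L.Bth := by
  have hc := L.c_pos
  have hPC := L.PC_nonneg
  have := Real.sq_sqrt (show 0 ≤ L.c * (4 * L.PC + L.c) by positivity)
  unfold Bth
  linear_combination (1 / 4) * this

/-- Places `Bth` in the range of contact points allowed by `exp_neg_div_lt_tangent`. -/
theorem PC_add_c_le_Bth : L.PC + L.c ≤ L.Bth := by
  have hc := L.c_pos
  have hPC := L.PC_nonneg
  have : L.c ≤ √(L.c * (4 * L.PC + L.c)) := Real.le_sqrt_of_sq_le (by nlinarith)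
  unfold Bth
  linarith

/-- Probability that Rayleigh fading allows decoding of a packet sent at power `p`. -/
noncomputable def decodeProb (p : ℝ) : ℝ :=
  if 0 < p then Real.exp (-(((2 : ℝ) ^ L.R - 1) * L.z / p)) else 0

theorem decodeProb_nonneg (p : ℝ) : 0 ≤ L.decodeProb p := by
  unfold decodeProb; split_ifs <;> positivity

theorem decodeProb_le_one (p : ℝ) : L.decodeProb p ≤ 1 := by
  unfold decodeProb
  split_ifs with h
  · have h1 : (1 : ℝ) < 2 ^ L.R := Real.one_lt_rpow one_lt_two L.R_pos
    have : 0 < (2 : ℝ) ^ L.R - 1 := by linarith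
    have := L.z_pos
    rw [Real.exp_le_one_iff, neg_nonpos]
    positivity
  · exact zero_le_one

@[fun_prop]
theorem measurable_decodeProb : Measurable L.decodeProb :=
  Measurable.ite measurableSet_Ioi (by fun_prop) measurable_const

theorem decodeProb_of_pos {p : ℝ} (hp : 0 < p) :
    L.decodeProb p = Real.exp (-L.c / (L.consumption p - L.PC)) := by
  have := L.α_pos
  rw [decodeProb, if_pos hp, consumption, if_pos hp, c]
  congr 1
  field_simp
  ring

/-- Decoding probability per slot, as a function of the consumed power. -/
noncomputable def gain (P : ℝ) : ℝ := Real.exp (-L.c / (P - L.PC))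

/-- Slope of `gain`. -/
noncomputable def gainSlope (P : ℝ) : ℝ := L.gain P * L.c / (P - L.PC) ^ 2

theorem PC_add_c_le {P : ℝ} (hP : L.Bth ≤ P) : L.PC + L.c ≤ P := L.PC_add_c_le_Bth.trans hP

theorem gainSlope_pos {P : ℝ} (hP : L.Bth ≤ P) : 0 < L.gainSlope P := by
  have := L.c_pos
  have : 0 < P - L.PC := by linarith [L.PC_add_c_le hP]
  unfold gainSlope gain
  positivity

theorem gain_lt_tangent {P Q : ℝ} (hP : L.Bth ≤ P) (hQ : L.PC < Q) (hQP : Q ≠ P) :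
    L.gain Q < L.gain P + L.gainSlope P * (Q - P) := by
  have h := exp_neg_div_lt_tangent (x := Q - L.PC) (y := P - L.PC) L.c_pos (by linarith)
    (by linarith [L.PC_add_c_le hP]) (by simpa using hQP)
  unfold gainSlope gain
  convert h using 3
  ring

theorem gainSlope_Bth : L.gainSlope L.Bth * L.Bth = L.gain L.Bth := by
  have hB : 0 < L.Bth := by linarith [L.PC_add_c_le_Bth, L.c_pos, L.PC_nonneg]
  have := L.c_pos
  rw [gainSlope, L.Bth_sub_PC_sq]
  field_simp

/-- Beyond the larger root, `(P - P_C) ^ 2 - c * P` is nonnegative. Geometrically, the tangent has a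
nonnegative intercept, so it also dominates silent slots. -/
theorem gainSlope_mul_le {P : ℝ} (hP : L.Bth ≤ P) : L.gainSlope P * P ≤ L.gain P := by
  have hc := L.c_pos
  have hPC := L.PC_nonneg
  have hB := L.PC_add_c_le_Bth
  have hpos : 0 < P - L.PC := by linarith
  have h1 : L.c * P ≤ (P - L.PC) ^ 2 := by
    have := L.Bth_sub_PC_sq
    nlinarith [mul_nonneg (sub_nonneg.2 hP) (show 0 ≤ P + L.Bth - 2 * L.PC - L.c by linarith)]
  have hg : 0 < L.gain P := Real.exp_pos _
  rw [gainSlope, div_mul_eq_mul_div, div_le_iff₀ (by positivity), mul_assoc]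
  exact mul_le_mul_of_nonneg_left h1 hg.le

theorem decodeProb_le_tangent {P p : ℝ} (hP : L.Bth ≤ P) (hp : 0 ≤ p) :
    L.decodeProb p ≤ L.gain P + L.gainSlope P * (L.consumption p - P) := by
  have hα := L.α_pos
  rcases hp.eq_or_lt with rfl | hp
  · have := L.gainSlope_mul_le hP
    simp only [decodeProb, consumption, lt_irrefl, if_false]
    linarith
  · rw [L.decodeProb_of_pos hp]
    change L.gain (L.consumption p) ≤ _
    by_cases h : L.consumption p = P
    · rw [h]; simp
    · refine (L.gain_lt_tangent hP ?_ h).le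
      rw [consumption, if_pos hp]
      have : 0 < (1 + L.α) * p := by positivity
      linarith

/-- The value of the tangent at the harvesting rate is attained by the optimal threshold. -/
theorem gain_mul_eq {lam : ℝ} :
    L.gain (max lam L.Bth) * (min lam (max lam L.Bth) / max lam L.Bth)
      = L.gain (max lam L.Bth) + L.gainSlope (max lam L.Bth) * (lam - max lam L.Bth) := by
  have hB : 0 < L.Bth := by linarith [L.PC_add_c_le_Bth, L.c_pos, L.PC_nonneg]
  rw [min_eq_left (le_max_left _ _)]
  -- If `lam ≤ Bth` the tangent is a line through the origin, met by mixing silence with `Bth`;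
  -- otherwise the point of contact is `lam` itself.
  rcases le_total lam L.Bth with h | h
  · rw [max_eq_right h, ← L.gainSlope_Bth]
    field_simp
    ring
  · rw [max_eq_left h, div_self (hB.trans_le h).ne']
    ring

/-- If `P ≤ lam`, the value is `gain P`, strictly below an increasing line. If `P ≥ lam`, it is the
mixture of silence and `P` with weight `lam / P`: the strict inequality at `P` is scaled by this
weight, and the nonnegative intercept covers the silent slots. -/
theorem gain_mul_lt {lam P : ℝ} (hlam : 0 < lam) (hP : L.PC < P) (hne : P ≠ max lam L.Bth) :
    L.gain P * (min lam P / P)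
      < L.gain (max lam L.Bth) + L.gainSlope (max lam L.Bth) * (lam - max lam L.Bth) := by
  have hP0 : 0 < P := L.PC_nonneg.trans_lt hP
  have hB := le_max_right lam L.Bth
  have h1 := L.gain_lt_tangent hB hP hne
  have h2 := L.gainSlope_mul_le hB
  have h3 := L.gainSlope_pos hB
  rcases le_total P lam with h | h
  · rw [min_eq_right h, div_self hP0.ne', mul_one]
    have := mul_le_mul_of_nonneg_left h h3.le
    linarith
  · rw [min_eq_left h]
    have h4 : 0 < lam / P := by positivity
    have h5 : lam / P ≤ 1 := (div_le_one hP0).2 h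
    have h6 := mul_lt_mul_of_pos_right h1 h4
    have h7 : (L.gain (max lam L.Bth) + L.gainSlope (max lam L.Bth) * (P - max lam L.Bth))
        * (lam / P) = (L.gain (max lam L.Bth) - L.gainSlope (max lam L.Bth) * max lam L.Bth)
          * (lam / P) + L.gainSlope (max lam L.Bth) * lam := by
      field_simp; ring
    have h8 := mul_le_mul_of_nonneg_left h5 (sub_nonneg.2 h2)
    linarith

theorem consumption_thresholdPolicy {P : ℝ} (hP : L.PC < P) (b : ℝ) (u : unitInterval) :
    L.consumption (L.thresholdPolicy P b u) = if P ≤ b then P else 0 := by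
  have hα := L.α_pos
  unfold thresholdPolicy consumption
  split_ifs with h1 h2 h2
  · field_simp; ring
  · exact absurd (div_pos (sub_pos.2 hP) (by linarith)) h2
  · exact absurd h2 (lt_irrefl _)
  · simp

theorem decodeProb_thresholdPolicy {P : ℝ} (hP : L.PC < P) (b : ℝ) (u : unitInterval) :
    L.decodeProb (L.thresholdPolicy P b u) = if P ≤ b then L.gain P else 0 := by
  have hα := L.α_pos
  by_cases h : P ≤ b
  · have h1 : 0 < L.thresholdPolicy P b u := by
      rw [thresholdPolicy, if_pos h]; exact div_pos (sub_pos.2 hP) (by linarith)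
    rw [L.decodeProb_of_pos h1, L.consumption_thresholdPolicy hP, if_pos h, if_pos h, gain]
  · simp [thresholdPolicy, h, decodeProb]

theorem isStationaryPolicy_thresholdPolicy {P : ℝ} (hP : L.PC < P) :
    L.IsStationaryPolicy (L.thresholdPolicy P) where
  measurable := Measurable.ite (measurableSet_le measurable_const measurable_fst)
    measurable_const measurable_const
  nonneg b _ u := by
    have := L.α_pos
    unfold thresholdPolicy
    split_ifs
    · exact (div_pos (sub_pos.2 hP) (by linarith)).le
    · exact le_rfl
  consumption_le b hb u := by
    rw [L.consumption_thresholdPolicy hP]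
    split_ifs with h
    · exact h
    · exact hb

end EHLink

/-! ### Independence and factorization of the outage probability. -/

/-- The joint law is a threefold product, whose factors can be regrouped. This moves the private
randomization to the side of `S`, independent of `D`. -/
theorem ProbabilityTheory.IndepFun.prodMk_right_comm {Ω α β γ : Type*} [MeasurableSpace Ω]
    [MeasurableSpace α] [MeasurableSpace β] [MeasurableSpace γ] {μ : Measure Ω}
    [IsProbabilityMeasure μ] {f : Ω → α} {g : Ω → β} {k : Ω → γ} (hf : Measurable f)
    (hg : Measurable g) (hk : Measurable k) (hfg : IndepFun f g μ)
    (hfgk : IndepFun (fun ω => (f ω, g ω)) k μ) : IndepFun (fun ω => (f ω, k ω)) g μ := by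
  have hfk : IndepFun f k μ := hfgk.comp measurable_fst measurable_id
  have := Measure.isProbabilityMeasure_map (μ := μ) hf.aemeasurable
  have := Measure.isProbabilityMeasure_map (μ := μ) hg.aemeasurable
  have := Measure.isProbabilityMeasure_map (μ := μ) hk.aemeasurable
  rw [indepFun_iff_map_prod_eq_prod_map_map (by fun_prop) (by fun_prop)] at hfg hfgk hfk ⊢
  rw [hfk]
  have h1 : MeasurePreserving (fun p : (α × β) × γ => ((p.1.1, p.2), p.1.2))
      (((μ.map f).prod (μ.map g)).prod (μ.map k)) (((μ.map f).prod (μ.map k)).prod (μ.map g)) :=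
    ((measurePreserving_prodAssoc _ _ _).symm MeasurableEquiv.prodAssoc).comp
      (((MeasurePreserving.id (μ.map f)).prod
        (Measure.measurePreserving_swap (μ := μ.map g) (ν := μ.map k))).comp
          (measurePreserving_prodAssoc (μ.map f) (μ.map g) (μ.map k)))
  rw [← h1.map_eq, ← hfg, ← hfgk, Measure.map_map h1.measurable (by fun_prop)]
  rfl

theorem measureReal_expMeasure_Ici {a : ℝ} (ha : 0 ≤ a) :
    (expMeasure 1).real (Set.Ici a) = Real.exp (-a) := by
  have := isProbabilityMeasure_expMeasure one_pos
  have hna : NullSingletonClass (expMeasure 1) :=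
    ⟨fun x => withDensity_absolutelyContinuous _ _ (measure_singleton x)⟩
  have h1 : (expMeasure 1).real (Set.Iic a) = 1 - Real.exp (-a) := by
    rw [← cdf_eq_real, cdf_expMeasure_eq one_pos, if_pos ha, one_mul]
  rw [← measureReal_congr Ioi_ae_eq_Ici, ← Set.compl_Iic, probReal_compl_eq_one_sub measurableSet_Iic, h1]
  ring

namespace EHLink

variable (L : EHLink)

@[fun_prop]
theorem measurable_consumption : Measurable L.consumption :=
  (measurable_const.mul measurable_id).add
    (Measurable.ite measurableSet_Ioi measurable_const measurable_const)

theorem R_le_mutualInfo_iff {p : ℝ} (hp : 0 < p) (h : ℂ) :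
    L.R ≤ L.mutualInfo p h ↔ ((2 : ℝ) ^ L.R - 1) * L.z / p ≤ ‖h‖ ^ 2 := by
  have hz := L.z_pos
  have : 0 < 1 + ‖h‖ ^ 2 * p / L.z := by positivity
  rw [mutualInfo, Real.le_logb_iff_rpow_le one_lt_two this, div_le_iff₀ hp,
    ← sub_le_iff_le_add', le_div_iff₀ hz]

theorem measureReal_le_sq_eq_decodeProb {p : ℝ} (hp : 0 < p) :
    (expMeasure 1).real {y | ((2 : ℝ) ^ L.R - 1) * L.z / p ≤ y} = L.decodeProb p := by
  have h1 : (1 : ℝ) < 2 ^ L.R := Real.one_lt_rpow one_lt_two L.R_pos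
  have : 0 < (2 : ℝ) ^ L.R - 1 := by linarith
  have := L.z_pos
  rw [decodeProb, if_pos hp]
  exact measureReal_expMeasure_Ici (by positivity)

end EHLink

namespace EHInputs

variable {Ω : Type*} (X : EHInputs Ω) (L : EHLink)

section measurability

variable [MeasurableSpace Ω]

theorem measurable_batteryS {π : ℝ → unitInterval → ℝ} (hπ : Measurable (Function.uncurry π))
    (h0 : Measurable X.BS0) (hE : ∀ t, Measurable (X.ES t)) (hU : ∀ t, Measurable (X.U t))
    (t : ℕ) : Measurable (X.batteryS L π t) := by
  induction t with
  | zero => exact h0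
  | succ t ih =>
    exact (ih.sub (L.measurable_consumption.comp (hπ.comp (ih.prodMk (hU t))))).add (hE t)

theorem measurable_txPower {π : ℝ → unitInterval → ℝ} (hπ : Measurable (Function.uncurry π))
    (h0 : Measurable X.BS0) (hE : ∀ t, Measurable (X.ES t)) (hU : ∀ t, Measurable (X.U t))
    (t : ℕ) : Measurable (X.txPower L π t) :=
  hπ.comp ((X.measurable_batteryS L hπ h0 hE hU t).prodMk (hU t))

theorem measurable_batteryD (h0 : Measurable X.BD0) (hE : ∀ t, Measurable (X.ED t)) (t : ℕ) :
    Measurable (X.batteryD L t) := by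
  induction t with
  | zero => exact h0
  | succ t ih =>
    exact (ih.sub (Measurable.ite (measurableSet_le measurable_const ih) measurable_const
      measurable_const)).add (hE t)

end measurability

/-- The inputs of `S` on the space of their realizations. -/
def canonicalS : EHInputs ((ℝ × (ℕ → ℝ)) × (ℕ → unitInterval)) where
  ES t w := w.1.2 t
  ED _ _ := 0
  BS0 w := w.1.1
  BD0 _ := 0
  U t w := w.2 t
  h _ _ := 0

/-- The inputs of `D` on the space of their realizations. -/
def canonicalD : EHInputs (ℝ × (ℕ → ℝ)) where
  ES _ _ := 0
  ED t w := w.2 t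
  BS0 _ := 0
  BD0 w := w.1
  U _ _ := 0
  h _ _ := 0

/-- Exhibits the battery as a fixed function of the realized inputs of `S`, so that independence of
the inputs passes to the batteries through `IndepFun.comp`. -/
theorem batteryS_canonicalS (π : ℝ → unitInterval → ℝ) (t : ℕ) (ω : Ω) :
    canonicalS.batteryS L π t (X.sideS ω, fun t => X.U t ω) = X.batteryS L π t ω := by
  induction t with
  | zero => rfl
  | succ t ih => simp only [batteryS, ih]; rfl

theorem batteryD_canonicalD (t : ℕ) (ω : Ω) :
    canonicalD.batteryD L t (X.sideD ω) = X.batteryD L t ω := by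
  induction t with
  | zero => rfl
  | succ t ih => simp only [batteryD, ih]; rfl

theorem batteryS_nonneg {π : ℝ → unitInterval → ℝ} (hπ : L.IsStationaryPolicy π)
    (h0 : ∀ ω, 0 ≤ X.BS0 ω) (hE : ∀ t ω, 0 ≤ X.ES t ω) (t : ℕ) (ω : Ω) :
    0 ≤ X.batteryS L π t ω := by
  induction t with
  | zero => exact h0 ω
  | succ t ih =>
    have := hπ.consumption_le _ ih (X.U t ω)
    have := hE t ω
    rw [batteryS]
    linarith

end EHInputs

namespace EHInputs.IsModel

variable {Ω : Type*} [MeasurableSpace Ω] {μ : Measure Ω}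
  {X : EHInputs Ω} (L : EHLink)

theorem measurable_sideS (hX : X.IsModel μ) : Measurable X.sideS :=
  hX.measurable_BS0.prodMk (measurable_pi_lambda _ hX.measurable_ES)

theorem measurable_sideD (hX : X.IsModel μ) : Measurable X.sideD :=
  hX.measurable_BD0.prodMk (measurable_pi_lambda _ hX.measurable_ED)

theorem measurable_txPower (hX : X.IsModel μ) {π : ℝ → unitInterval → ℝ}
    (hπ : L.IsStationaryPolicy π) (t : ℕ) : Measurable (X.txPower L π t) :=
  X.measurable_txPower L hπ.measurable hX.measurable_BS0 hX.measurable_ES hX.measurable_U t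

theorem measurable_batteryD (hX : X.IsModel μ) (t : ℕ) : Measurable (X.batteryD L t) :=
  X.measurable_batteryD L hX.measurable_BD0 hX.measurable_ED t

/-- Transmission power and receiver battery are independent. -/
theorem indepFun_txPower_batteryD [IsProbabilityMeasure μ] (hX : X.IsModel μ) {π : ℝ → unitInterval → ℝ}
    (hπ : L.IsStationaryPolicy π) (t : ℕ) :
    IndepFun (X.txPower L π t) (X.batteryD L t) μ := by
  have h := IndepFun.prodMk_right_comm hX.measurable_sideS hX.measurable_sideD
    (measurable_pi_lambda _ hX.measurable_U) hX.indep_S_D hX.indep_U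
  have h1 : Measurable (canonicalS.txPower L π t) :=
    canonicalS.measurable_txPower L hπ.measurable (by unfold canonicalS; fun_prop)
      (by unfold canonicalS; fun_prop) (by unfold canonicalS; fun_prop) t
  have h2 : Measurable (canonicalD.batteryD L t) :=
    canonicalD.measurable_batteryD L (by unfold canonicalD; fun_prop)
      (by unfold canonicalD; fun_prop) t
  have h3 := h.comp h1 h2
  have e1 : canonicalS.txPower L π t ∘ (fun ω => (X.sideS ω, fun t => X.U t ω))
      = X.txPower L π t := by
    ext ω
    simp only [Function.comp, txPower, batteryS_canonicalS]
    rfl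
  have e2 : canonicalD.batteryD L t ∘ X.sideD = X.batteryD L t := by
    ext ω
    exact batteryD_canonicalD X L t ω
  rwa [e1, e2] at h3

/-- The fading in slot `t` is independent of transmission power and receiver battery. -/
theorem indepFun_fading (hX : X.IsModel μ) {π : ℝ → unitInterval → ℝ}
    (hπ : L.IsStationaryPolicy π) (t : ℕ) :
    IndepFun (fun ω => (X.txPower L π t ω, X.batteryD L t ω)) (fun ω => ‖X.h t ω‖ ^ 2) μ := by
  have h1 : Measurable (canonicalS.txPower L π t) :=
    canonicalS.measurable_txPower L hπ.measurable (by unfold canonicalS; fun_prop)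
      (by unfold canonicalS; fun_prop) (by unfold canonicalS; fun_prop) t
  have h2 : Measurable (canonicalD.batteryD L t) :=
    canonicalD.measurable_batteryD L (by unfold canonicalD; fun_prop)
      (by unfold canonicalD; fun_prop) t
  have hf : Measurable fun w : ((ℝ × (ℕ → ℝ)) × (ℝ × (ℕ → ℝ))) × (ℕ → unitInterval) =>
      (canonicalS.txPower L π t (w.1.1, w.2), canonicalD.batteryD L t w.1.2) :=
    (h1.comp (by fun_prop)).prodMk (h2.comp (measurable_snd.comp measurable_fst))
  have h3 := hX.indep_h.comp hf
    (show Measurable fun v : ℕ → ℂ => ‖v t‖ ^ 2 by fun_prop)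
  have e1 : (fun w : ((ℝ × (ℕ → ℝ)) × (ℝ × (ℕ → ℝ))) × (ℕ → unitInterval) =>
      (canonicalS.txPower L π t (w.1.1, w.2), canonicalD.batteryD L t w.1.2))
      ∘ (fun ω => ((X.sideS ω, X.sideD ω), fun t => X.U t ω))
      = fun ω => (X.txPower L π t ω, X.batteryD L t ω) := by
    ext ω
    · simp only [Function.comp, txPower, batteryS_canonicalS]
      rfl
    · exact batteryD_canonicalD X L t ω
  rw [e1] at h3
  exact h3

variable [IsProbabilityMeasure μ]

/-- The outage probability factorizes. -/
theorem measureReal_outageEvent (hX : X.IsModel μ) {π : ℝ → unitInterval → ℝ}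
    (hπ : L.IsStationaryPolicy π) (t : ℕ) :
    μ.real (X.outageEvent L π t)
      = 1 - (∫ ω, L.decodeProb (X.txPower L π t ω) ∂μ)
          * μ.real {ω | L.PD ≤ X.batteryD L t ω} := by
  have hp := hX.measurable_txPower L hπ t
  have hb := hX.measurable_batteryD L t
  have hy : Measurable fun ω => ‖X.h t ω‖ ^ 2 := (hX.measurable_h t).norm.pow_const 2
  set V : Ω → ℝ × ℝ := fun ω => (X.txPower L π t ω, X.batteryD L t ω) with hVdef
  have hV : Measurable V := hp.prodMk hb
  let T : Set ((ℝ × ℝ) × ℝ) :=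
    ({w | 0 < w.1.1} ∩ {w | L.PD ≤ w.1.2}) ∩ {w | ((2 : ℝ) ^ L.R - 1) * L.z / w.1.1 ≤ w.2}
  have hT : MeasurableSet T :=
    ((measurableSet_lt measurable_const (by fun_prop)).inter
      (measurableSet_le measurable_const (by fun_prop))).inter
        (measurableSet_le (by fun_prop) (by fun_prop))
  have hVy : Measurable fun ω => (V ω, ‖X.h t ω‖ ^ 2) := hV.prodMk hy
  have hout : X.outageEvent L π t = ((fun ω => (V ω, ‖X.h t ω‖ ^ 2)) ⁻¹' T)ᶜ := by
    ext ω
    simp only [outageEvent, Set.mem_ofPred_eq, Set.mem_compl_iff, Set.mem_preimage, Set.mem_inter_iff, T, hVdef,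
      not_iff_not, and_assoc]
    constructor
    · rintro ⟨h1, h2, h3⟩
      exact ⟨h1, h2, (L.R_le_mutualInfo_iff h1 _).1 h3⟩
    · rintro ⟨h1, h2, h3⟩
      exact ⟨h1, h2, (L.R_le_mutualInfo_iff h1 _).2 h3⟩
  have hpV := Measure.isProbabilityMeasure_map (μ := μ) hV.aemeasurable
  have hexp := isProbabilityMeasure_expMeasure one_pos
  have hlaw : μ.map (fun ω => (V ω, ‖X.h t ω‖ ^ 2)) = (μ.map V).prod (expMeasure 1) := by
    rw [← hX.rayleigh_h t]
    exact (indepFun_iff_map_prod_eq_prod_map_map hV.aemeasurable hy.aemeasurable).1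
      (hX.indepFun_fading L hπ t)
  -- For fixed power and receiver battery, success is a tail event of the exponential fading, or
  -- empty.
  have hsec : ∀ v : ℝ × ℝ, (expMeasure 1).real (Prod.mk v ⁻¹' T)
      = L.decodeProb v.1 * (Set.Ici L.PD).indicator 1 v.2 := by
    intro v
    by_cases h1 : 0 < v.1
    · by_cases h2 : L.PD ≤ v.2
      · have : Prod.mk v ⁻¹' T = {y | ((2 : ℝ) ^ L.R - 1) * L.z / v.1 ≤ y} := by
          ext y; simp [T, h1, h2]
        rw [this, L.measureReal_le_sq_eq_decodeProb h1,
          Set.indicator_of_mem (Set.mem_Ici.2 h2), Pi.one_apply, mul_one]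
      · have : Prod.mk v ⁻¹' T = ∅ := by
          ext y; simp [T, h2]
        rw [this, Set.indicator_of_notMem (by simpa using h2)]
        simp
    · have : Prod.mk v ⁻¹' T = ∅ := by
        ext y; simp [T, h1]
      rw [this, EHLink.decodeProb, if_neg h1]
      simp
  have hprod : ((μ.map V).prod (expMeasure 1)).real T
      = ∫ v, (expMeasure 1).real (Prod.mk v ⁻¹' T) ∂(μ.map V) := by
    rw [measureReal_def, Measure.prod_apply hT, integral_eq_lintegral_of_nonneg_ae
      (ae_of_all _ fun _ => measureReal_nonneg)
      (measurable_measure_prodMk_left hT).ennreal_toReal.aestronglyMeasurable]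
    congr 1
    refine lintegral_congr fun v => ?_
    rw [measureReal_def, ENNReal.ofReal_toReal (measure_ne_top _ _)]
  have hind : Measurable ((Set.Ici L.PD).indicator (1 : ℝ → ℝ)) :=
    measurable_one.indicator measurableSet_Ici
  rw [hout, probReal_compl_eq_one_sub (hVy hT), ← map_measureReal_apply hVy hT, hlaw, hprod]
  simp only [hsec]
  have hF : Measurable fun v : ℝ × ℝ =>
      L.decodeProb v.1 * (Set.Ici L.PD).indicator (1 : ℝ → ℝ) v.2 :=
    (L.measurable_decodeProb.comp measurable_fst).mul (hind.comp measurable_snd)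
  rw [integral_map hV.aemeasurable hF.aestronglyMeasurable]
  have h4 := ((hX.indepFun_txPower_batteryD L hπ t).comp L.measurable_decodeProb
    hind).integral_fun_mul_eq_mul_integral
    (L.measurable_decodeProb.comp hp).aestronglyMeasurable (hind.comp hb).aestronglyMeasurable
  have h5 : ∫ ω, ((Set.Ici L.PD).indicator (1 : ℝ → ℝ) ∘ X.batteryD L t) ω ∂μ
      = μ.real {ω | L.PD ≤ X.batteryD L t ω} :=
    integral_indicator_one (μ := μ) (measurableSet_le measurable_const hb)
  rw [h5] at h4
  exact congrArg (1 - ·) h4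

end EHInputs.IsModel

/-! ### Asymptotic outage and optimality. -/

/-- Cesàro convergence of `ψ` alone would not suffice, since `φ` could be correlated in time with
its fluctuations; absolute deviations rule this out. -/
theorem tendsto_avg_mul_sub {φ ψ : ℕ → ℝ} {l : ℝ} (hφ0 : ∀ t, 0 ≤ φ t) (hφ1 : ∀ t, φ t ≤ 1)
    (hψ : Tendsto (fun n : ℕ => (∑ t ∈ Finset.range n, |ψ t - l|) / n) atTop (𝓝 0)) :
    Tendsto (fun n : ℕ => (∑ t ∈ Finset.range n, φ t * ψ t) / n
      - l * ((∑ t ∈ Finset.range n, φ t) / n)) atTop (𝓝 0) := by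
  refine squeeze_zero_norm (fun n => ?_) hψ
  have h1 : (∑ t ∈ Finset.range n, φ t * ψ t) / n - l * ((∑ t ∈ Finset.range n, φ t) / n)
      = (∑ t ∈ Finset.range n, φ t * (ψ t - l)) / n := by
    simp only [mul_sub, Finset.sum_sub_distrib, ← Finset.sum_mul]
    ring
  rw [h1, Real.norm_eq_abs, abs_div, Nat.abs_cast]
  gcongr
  refine (Finset.abs_sum_le_sum_abs _ _).trans (Finset.sum_le_sum fun t _ => ?_)
  rw [abs_mul, abs_of_nonneg (hφ0 t)]
  exact mul_le_of_le_one_left (abs_nonneg _) (hφ1 t)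

namespace EHInputs.IsModel

variable {Ω : Type*} [MeasurableSpace Ω] {μ : Measure Ω} [IsProbabilityMeasure μ]
  {X : EHInputs Ω} (L : EHLink)

/-- The probability that `D` is active averages to `min λ_D P_D / P_D`, strongly. -/
theorem tendsto_avg_abs_active_sub (hX : X.IsModel μ)
    (hsteady : ∫ ω, X.ED 0 ω ∂μ < L.PD →
      ∃ ψ : ℝ, Tendsto (fun t => μ.real {ω | L.PD ≤ X.batteryD L t ω}) atTop (𝓝 ψ)) :
    Tendsto (fun n : ℕ => (∑ t ∈ Finset.range n,
      |μ.real {ω | L.PD ≤ X.batteryD L t ω} - min (∫ ω, X.ED 0 ω ∂μ) L.PD / L.PD|) / n)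
      atTop (𝓝 0) := by
  have hlim := tendsto_avg_active (μ := μ) hX.stationaryErgodic_ED hX.measurable_ED hX.ED_nonneg
    hX.integrable_ED (hX.measurable_batteryD L) hX.BD0_nonneg L.PD_pos (fun t ω => rfl)
  -- If `λ_D < P_D`, the assumed limit must agree with the Cesàro limit. Otherwise the Cesàro limit
  -- is `1`, an upper bound for every term, so the absolute deviations are just `1` minus the terms
  -- and no steady state is needed.
  rcases lt_or_ge (∫ ω, X.ED 0 ω ∂μ) L.PD with h | h
  · obtain ⟨ψ, hψ⟩ := hsteady h
    have hc := hψ.cesaro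
    simp only [← div_eq_inv_mul] at hc
    rw [← tendsto_nhds_unique hc hlim]
    have h1 := (tendsto_iff_norm_sub_tendsto_zero.1 hψ).cesaro
    simpa only [← div_eq_inv_mul, Real.norm_eq_abs] using h1
  · rw [min_eq_right h, div_self L.PD_pos.ne'] at hlim ⊢
    have h1 := (tendsto_const_nhds (x := (1 : ℝ))).sub hlim
    rw [sub_self] at h1
    refine h1.congr' ?_
    filter_upwards [eventually_gt_atTop 0] with n hn
    have hn' : (n : ℝ) ≠ 0 := by exact_mod_cast hn.ne'
    have h2 : ∀ t, |μ.real {ω | L.PD ≤ X.batteryD L t ω} - 1|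
        = 1 - μ.real {ω | L.PD ≤ X.batteryD L t ω} := fun t => by
      rw [abs_of_nonpos (sub_nonpos.2 measureReal_le_one), neg_sub]
    simp only [h2, Finset.sum_sub_distrib, Finset.sum_const, Finset.card_range, nsmul_eq_mul,
      mul_one, sub_div, div_self hn']

/-- Asymptotically, the average outage probability is determined by the average decoding
probability and the fraction of slots in which `D` is active. -/
theorem tendsto_avgOutage_add (hX : X.IsModel μ)
    (hsteady : ∫ ω, X.ED 0 ω ∂μ < L.PD →
      ∃ ψ : ℝ, Tendsto (fun t => μ.real {ω | L.PD ≤ X.batteryD L t ω}) atTop (𝓝 ψ))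
    {π : ℝ → unitInterval → ℝ} (hπ : L.IsStationaryPolicy π) :
    Tendsto (fun n : ℕ => X.avgOutage L μ π n + min (∫ ω, X.ED 0 ω ∂μ) L.PD / L.PD
      * ((∑ t ∈ Finset.range n, ∫ ω, L.decodeProb (X.txPower L π t ω) ∂μ) / n))
      atTop (𝓝 1) := by
  have hle : ∀ t, ∫ ω, L.decodeProb (X.txPower L π t ω) ∂μ ≤ 1 := fun t => by
    have := norm_integral_le_of_norm_le_const (μ := μ) (C := 1)
      (f := fun ω => L.decodeProb (X.txPower L π t ω)) (ae_of_all _ fun ω => by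
        rw [Real.norm_eq_abs, abs_of_nonneg (L.decodeProb_nonneg _)]
        exact L.decodeProb_le_one _)
    rw [probReal_univ, mul_one] at this
    exact (le_abs_self _).trans this
  have h1 := tendsto_avg_mul_sub
    (φ := fun t => ∫ ω, L.decodeProb (X.txPower L π t ω) ∂μ)
    (fun t => integral_nonneg fun ω => L.decodeProb_nonneg _) hle
    (hX.tendsto_avg_abs_active_sub L hsteady)
  have h2 := (tendsto_const_nhds (x := (1 : ℝ))).sub h1
  rw [sub_zero] at h2
  refine h2.congr' ?_
  filter_upwards [eventually_gt_atTop 0] with n hn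
  have hn' : (n : ℝ) ≠ 0 := by exact_mod_cast hn.ne'
  rw [avgOutage]
  simp only [hX.measureReal_outageEvent L hπ, Finset.sum_sub_distrib, Finset.sum_const,
    Finset.card_range, nsmul_eq_mul, mul_one, sub_div, div_self hn']
  ring

theorem tendsto_avgOutage_thresholdPolicy (hX : X.IsModel μ)
    (hsteady : ∫ ω, X.ED 0 ω ∂μ < L.PD →
      ∃ ψ : ℝ, Tendsto (fun t => μ.real {ω | L.PD ≤ X.batteryD L t ω}) atTop (𝓝 ψ))
    {P : ℝ} (hP : L.PC < P) :
    Tendsto (X.avgOutage L μ (L.thresholdPolicy P)) atTop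
      (𝓝 (1 - min (∫ ω, X.ED 0 ω ∂μ) L.PD / L.PD
        * (L.gain P * (min (∫ ω, X.ES 0 ω ∂μ) P / P)))) := by
  have hπ := L.isStationaryPolicy_thresholdPolicy hP
  have hBm : ∀ t, Measurable (X.batteryS L (L.thresholdPolicy P) t) :=
    X.measurable_batteryS L hπ.measurable hX.measurable_BS0 hX.measurable_ES hX.measurable_U
  have h1 := tendsto_avg_active (μ := μ) hX.stationaryErgodic_ES hX.measurable_ES hX.ES_nonneg
    hX.integrable_ES hBm hX.BS0_nonneg (L.PC_nonneg.trans_lt hP)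
    (fun t ω => by rw [batteryS, L.consumption_thresholdPolicy hP])
  have h2 : ∀ t, ∫ ω, L.decodeProb (X.txPower L (L.thresholdPolicy P) t ω) ∂μ
      = L.gain P * μ.real {ω | P ≤ X.batteryS L (L.thresholdPolicy P) t ω} := by
    intro t
    have h3 := integral_indicator_const (μ := μ) (L.gain P)
      (measurableSet_le measurable_const (hBm t) :
        MeasurableSet {ω | P ≤ X.batteryS L (L.thresholdPolicy P) t ω})
    rw [smul_eq_mul, mul_comm] at h3
    rw [← h3]
    refine integral_congr_ae (ae_of_all _ fun ω => ?_)
    simp only [txPower, L.decodeProb_thresholdPolicy hP, Set.indicator_apply, Set.mem_ofPred_eq]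
  have h4 := (hX.tendsto_avgOutage_add L hsteady hπ).sub
    ((h1.const_mul (L.gain P)).const_mul (min (∫ ω, X.ED 0 ω ∂μ) L.PD / L.PD))
  refine h4.congr fun n => ?_
  simp only [h2, ← Finset.mul_sum]
  ring

/-- No stationary policy has an average decoding probability above the tangent value. -/
theorem eventually_avg_decodeProb_le (hX : X.IsModel μ) {π : ℝ → unitInterval → ℝ}
    (hπ : L.IsStationaryPolicy π) {P : ℝ} (hP : L.Bth ≤ P) {ε : ℝ} (hε : 0 < ε) :
    ∀ᶠ n : ℕ in atTop,
      (∑ t ∈ Finset.range n, ∫ ω, L.decodeProb (X.txPower L π t ω) ∂μ) / n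
        ≤ L.gain P + L.gainSlope P * (∫ ω, X.ES 0 ω ∂μ - P) + ε := by
  have h1 := eventually_avg_integral_le (μ := μ)
    (φ := fun t ω => L.decodeProb (X.txPower L π t ω)) (B₀ := X.BS0)
    -- `A` and `s` are the intercept and slope of the tangent at `P`; the sign of the intercept is
    -- where `Bth ≤ P` enters.
    (A := L.gain P - L.gainSlope P * P) (s := L.gainSlope P)
    hX.stationaryErgodic_ES hX.measurable_ES hX.ES_nonneg hX.integrable_ES hX.measurable_BS0
    (fun t => L.measurable_decodeProb.comp (hX.measurable_txPower L hπ t))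
    (fun t ω => L.decodeProb_nonneg _) (fun t ω => L.decodeProb_le_one _)
    (sub_nonneg.2 (L.gainSlope_mul_le hP)) (L.gainSlope_pos hP).le
    (fun n ω => by
      have hb := X.batteryS_nonneg L hπ hX.BS0_nonneg hX.ES_nonneg
      have h2 := battery_eq_sum (b := fun t => X.batteryS L π t ω)
        (q := fun t => L.consumption (X.txPower L π t ω)) (e := fun t => X.ES t ω)
        (fun t => rfl) n
      have h3 : ∑ t ∈ Finset.range n, L.decodeProb (X.txPower L π t ω)
          ≤ ∑ t ∈ Finset.range n, ((L.gain P - L.gainSlope P * P)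
            + L.gainSlope P * L.consumption (X.txPower L π t ω)) :=
        Finset.sum_le_sum fun t _ => by
          have := L.decodeProb_le_tangent hP (hπ.nonneg _ (hb t ω) (X.U t ω))
          simp only [txPower]
          linarith
      rw [Finset.sum_add_distrib, ← Finset.mul_sum, Finset.sum_const, Finset.card_range,
        nsmul_eq_mul] at h3
      refine h3.trans (add_le_add le_rfl
        (mul_le_mul_of_nonneg_left ?_ (L.gainSlope_pos hP).le))
      have h4 := hb n ω
      have h5 : X.batteryS L π 0 ω = X.BS0 ω := rfl
      simp only [h5] at h2
      linarith) hε
  filter_upwards [h1] with n hn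
  linarith

theorem avgOutage_le_one (n : ℕ) (π : ℝ → unitInterval → ℝ) : X.avgOutage L μ π n ≤ 1 := by
  refine div_le_one_of_le₀ ?_ (Nat.cast_nonneg n)
  simpa using Finset.sum_le_card_nsmul (Finset.range n) (fun t => μ.real (X.outageEvent L π t)) 1
    fun t _ => measureReal_le_one

theorem le_liminf_avgOutage (hX : X.IsModel μ)
    (hsteady : ∫ ω, X.ED 0 ω ∂μ < L.PD →
      ∃ ψ : ℝ, Tendsto (fun t => μ.real {ω | L.PD ≤ X.batteryD L t ω}) atTop (𝓝 ψ))
    {π : ℝ → unitInterval → ℝ} (hπ : L.IsStationaryPolicy π) {P : ℝ} (hP : L.Bth ≤ P) :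
    1 - min (∫ ω, X.ED 0 ω ∂μ) L.PD / L.PD
        * (L.gain P + L.gainSlope P * (∫ ω, X.ES 0 ω ∂μ - P))
      ≤ liminf (X.avgOutage L μ π) atTop := by
  have hψ0 : 0 ≤ min (∫ ω, X.ED 0 ω ∂μ) L.PD / L.PD :=
    div_nonneg (le_min (integral_nonneg (hX.ED_nonneg 0)) L.PD_pos.le) L.PD_pos.le
  have hψ1 : min (∫ ω, X.ED 0 ω ∂μ) L.PD / L.PD ≤ 1 :=
    (div_le_one L.PD_pos).2 (min_le_right _ _)
  refine le_of_forall_sub_le fun ε hε => ?_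
  -- The upper bound `1` keeps the real `liminf` from being a default value.
  have hbdd : IsCoboundedUnder (· ≥ ·) atTop (X.avgOutage L μ π) :=
    (isBoundedUnder_of ⟨1, fun n => avgOutage_le_one L n π⟩ :
      IsBoundedUnder (· ≤ ·) atTop _).isCoboundedUnder_ge
  refine le_liminf_of_le hbdd ?_
  filter_upwards [hX.eventually_avg_decodeProb_le L hπ hP (half_pos hε),
    (hX.tendsto_avgOutage_add L hsteady hπ).eventually
      (lt_mem_nhds (show 1 - ε / 2 < 1 by linarith))] with n h1 h2
  have h3 := mul_le_mul_of_nonneg_left h1 hψ0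
  rw [mul_add] at h3
  have h4 := mul_le_of_le_one_left (half_pos hε).le hψ1
  linarith

end EHInputs.IsModel

theorem theorem2 {Ω : Type*} [MeasurableSpace Ω] (μ : Measure Ω) [IsProbabilityMeasure μ]
    (L : EHLink) (X : EHInputs Ω) (hX : X.IsModel μ) (lamS lamD : ℝ)
    (hlamS : ∫ ω, X.ES 0 ω ∂μ = lamS) (hlamD : ∫ ω, X.ED 0 ω ∂μ = lamD)
    (hS : 0 < lamS) (hD : 0 < lamD)
    (hsteady : lamD < L.PD →
      ∃ ψ : ℝ, Tendsto (fun t => μ.real {ω | L.PD ≤ X.batteryD L t ω}) atTop (𝓝 ψ)) :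
    L.PC < max lamS L.Bth ∧
    L.IsStationaryPolicy (L.thresholdPolicy (max lamS L.Bth)) ∧
    ∃ pOut : ℝ,
      Tendsto (X.avgOutage L μ (L.thresholdPolicy (max lamS L.Bth))) atTop (𝓝 pOut) ∧
      (∀ π : ℝ → unitInterval → ℝ, L.IsStationaryPolicy π →
        pOut ≤ liminf (X.avgOutage L μ π) atTop) ∧
      (∀ P : ℝ, L.PC < P → P ≠ max lamS L.Bth →
        ∃ p : ℝ, Tendsto (X.avgOutage L μ (L.thresholdPolicy P)) atTop (𝓝 p) ∧ pOut < p) := by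
  subst hlamS hlamD
  have hPC : L.PC < max (∫ ω, X.ES 0 ω ∂μ) L.Bth := by
    linarith [L.PC_add_c_le (le_max_right (∫ ω, X.ES 0 ω ∂μ) L.Bth), L.c_pos]
  refine ⟨hPC, L.isStationaryPolicy_thresholdPolicy hPC, _,
    hX.tendsto_avgOutage_thresholdPolicy L hsteady hPC, fun π hπ => ?_, fun P hP hne =>
      ⟨_, hX.tendsto_avgOutage_thresholdPolicy L hsteady hP, ?_⟩⟩
  · rw [L.gain_mul_eq]
    exact hX.le_liminf_avgOutage L hsteady hπ (le_max_right _ _)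
  -- Strictness survives multiplication by the receiver's active fraction because `λ_D > 0` makes
  -- that fraction positive.
  · rw [L.gain_mul_eq]
    exact sub_lt_sub_left (mul_lt_mul_of_pos_left (L.gain_mul_lt hS hP hne)
      (div_pos (lt_min hD L.PD_pos) L.PD_pos)) 1
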